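/- Let $u>0$, $\alpha>0$, let $\nu$ be the uniform distribution on $(-\pi/2,\pi/2]$, and let $\rho$ be a probability measure on $[1,\infty)$ for which there is a constant $C>0$ with $C^{-1}r^{-\alpha}\le\rho[r,\infty)\le C r^{-\alpha}$ for all $r\ge 1$. The $(u,\rho)$-ellipses model is a Poisson point process $\xi$ on $S=\mathbb R^2\times[1,\infty)\times(-\pi/2,\pi/2]$ with intensity measure $(u\lambda)\otimes\rho\otimes\nu$, where $\lambda$ is Lebesgue measure on $\mathbb R^2$. A point $s=(z,R,V)\in S$ is identified with the filled ellipse $E(s)$ with centre $z$, semi-major axis $R$ in direction $(\cos V,\sin V)$, and semi-minor axis $1$. Write $B(r)$ for the closed Euclidean ball of radius $r$ centred at the origin of $\mathbb R^2$ (so $B(0)=\{0\}$), and for $n\in\mathbb N$ let $$N_n^{(\varepsilon)}=\#\{s\in\operatorname{supp}\xi:\ B(\varepsilon)\subset E(s),\ z\in B(n)\},\qquad s=(z,R,V).$$ Let $0\le\varepsilon<1/2$ be fixed. Then every $N_n^{(\varepsilon)}$ is almost surely finite and integrable, and: 1. If $0<\alpha<1$, then $E[N_n^{(\varepsilon)}]\asymp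 n^{1-\alpha}$ as $n\to\infty$, and for every fixed $\delta>0$, $$\frac{N_n^{(\varepsilon)}-E[N_n^{(\varepsilon)}]}{\sqrt{n^{1-\alpha}(\log n)^{1+\delta}}}\longrightarrow 0\quad\text{almost surely as } n\to\infty.$$ 2. If $\alpha=1$, then $E[N_n^{(\varepsilon)}]\asymp\log n$ as $n\to\infty$, and for every fixed $\delta>0$, $$\frac{N_n^{(\varepsilon)}-E[N_n^{(\varepsilon)}]}{n^{1/2}(\log n)^{1+\delta}}\longrightarrow 0\quad\text{almost surely as } n\to\infty.$$ Here $a_n\asymp b_n$ as $n\to\infty$ means that there are constants $0<c\le C'<\infty$ such that $c\,b_n\le a_n\le C'b_n$ for all sufficiently large $n$. -/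

import Mathlib

open MeasureTheory ProbabilityTheory Filter Topology

/-- The Euclidean plane. -/
abbrev Plane : Type := EuclideanSpace ℝ (Fin 2)

/-- A Poisson point process with intensity measure `μ`, viewed as a random countable, locally
finite set of points `Ξ ω` (the support of the point measure `∑ i, δ_{s i}`). This is the standard
description when the intensity has no atoms, since the points are then almost surely distinct. -/
structure IsPoissonPointProcess {Ω E : Type*} [MeasurableSpace Ω] [TopologicalSpace E]
    [MeasurableSpace E] (Ξ : Ω → Set E) (μ : Measure E) (P : Measure Ω) : Prop where
  /-- Every realisation is countable. -/
  countable : ∀ ω, (Ξ ω).Countable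
  /-- Every realisation is locally finite. -/
  locallyFinite : ∀ ω, ∀ K : Set E, IsCompact K → (Ξ ω ∩ K).Finite
  /-- The number of points in a measurable set is a random variable. -/
  measurable_count : ∀ A : Set E, MeasurableSet A → Measurable fun ω ↦ (Ξ ω ∩ A).encard
  /-- The number of points in a set of finite intensity has a Poisson law with mean `μ A`. -/
  map_count : ∀ A : Set E, MeasurableSet A → μ A ≠ ⊤ →
    P.map (fun ω ↦ (Ξ ω ∩ A).encard) =
      (poissonMeasure (μ A).toNNReal).map (fun k : ℕ ↦ (k : ℕ∞))
  /-- A set of infinite intensity almost surely contains infinitely many points. -/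
  count_eq_top : ∀ A : Set E, MeasurableSet A → μ A = ⊤ → ∀ᵐ ω ∂P, (Ξ ω ∩ A).encard = ⊤
  /-- The numbers of points in disjoint sets are independent. -/
  indep : ∀ (k : ℕ) (A : Fin k → Set E), (∀ i, MeasurableSet (A i)) →
    Pairwise (fun i j ↦ Disjoint (A i) (A j)) →
    iIndepFun (fun i ω ↦ (Ξ ω ∩ A i).encard) P

namespace EllipsesModel

/-- The parameter space `ℝ² × [1, ∞) × (-π/2, π/2]`: centre, size of the major axis, direction. -/
abbrev Params : Type :=
  Plane × Set.Ici (1 : ℝ) × Set.Ioc (-(Real.pi / 2)) (Real.pi / 2)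

/-- The centre of the ellipse with the given parameters. -/
def center (s : Params) : Plane := s.1

/-- The filled ellipse with centre `z`, semi-major axis `R` in direction `V` and semi-minor axis 1:
after translating `z` to the origin and rotating clockwise by `V`, it is `(x / R)² + y² ≤ 1`. -/
def ellipse (s : Params) : Set Plane :=
  {p | ((Real.cos s.2.2 * (p 0 - s.1 0) + Real.sin s.2.2 * (p 1 - s.1 1)) / (s.2.1 : ℝ)) ^ 2
      + (-Real.sin s.2.2 * (p 0 - s.1 0) + Real.cos s.2.2 * (p 1 - s.1 1)) ^ 2 ≤ 1}

/-- The uniform distribution on `(-π/2, π/2]`. -/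
noncomputable def directionLaw : Measure (Set.Ioc (-(Real.pi / 2)) (Real.pi / 2)) :=
  ENNReal.ofReal (Real.pi⁻¹) • Measure.comap Subtype.val (volume : Measure ℝ)

/-- The intensity measure `(u λ) ⊗ ρ ⊗ ν` of the `(u, ρ)`-ellipses model. -/
noncomputable def intensity (u : ℝ) (ρ : Measure (Set.Ici (1 : ℝ))) : Measure Params :=
  (ENNReal.ofReal u • (volume : Measure Plane)).prod (ρ.prod directionLaw)

/-- `ρ[r, ∞) ≍ r ^ (-α)` for `r ≥ 1`. -/
def HasTailDecay (ρ : Measure (Set.Ici (1 : ℝ))) (α : ℝ) : Prop :=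
  ∃ C : ℝ, 0 < C ∧ ∀ r : ℝ, 1 ≤ r →
    C⁻¹ * r ^ (-α) ≤ ρ.real {R | r ≤ (R : ℝ)} ∧ ρ.real {R | r ≤ (R : ℝ)} ≤ C * r ^ (-α)

/-- The `(u, ρ)`-ellipses model: a Poisson point process on the parameter space with intensity
`(u λ) ⊗ ρ ⊗ ν`. -/
def IsEllipsesModel {Ω : Type*} [MeasurableSpace Ω] (Ξ : Ω → Set Params) (u : ℝ)
    (ρ : Measure (Set.Ici (1 : ℝ))) (P : Measure Ω) : Prop :=
  IsPoissonPointProcess Ξ (intensity u ρ) P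

/-- The number of ellipses of the configuration `X` that are centred in the ball `B(n)` and
cover the ball `B(ε)`, possibly infinite. Balls are closed, so that `B(0) = {0}`. -/
noncomputable def numCovering (X : Set Params) (ε : ℝ) (n : ℕ) : ℕ∞ :=
  {s | s ∈ X ∧ Metric.closedBall (0 : Plane) ε ⊆ ellipse s ∧
    center s ∈ Metric.closedBall (0 : Plane) (n : ℝ)}.encard

end EllipsesModel

/-! For each `n` the count is the number of points of the process in one fixed closed set, hence
Poisson with mean `m n` equal to the intensity of that set.

For a given axis `R` and direction, the admissible centres contain and are contained in rotated
boxes with side lengths of order `min R n` and 1. So `m n` is comparable to the truncated mean `∫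
min R n ∂ρ`, which is the integral of the tail of `ρ` over `[0, n]`, and tail decay gives `n ^ (1 -
α)` or `log n`.

For the almost sure limit no relation between different `n` is used: the Chernoff bound
`poisson_law_tail`, with parameter `l n` making it at most `2 / n ^ 2`, is summable, and
Borel–Cantelli concludes (`poisson_ae_tendsto`). -/

/-! ### Moments of the Poisson law -/

lemma hasSum_exp_mul_poisson (r : NNReal) (t : ℝ) :
    HasSum (fun n : ℕ ↦ Real.exp (-r) * (r : ℝ) ^ n / n.factorial * Real.exp (t * n))
      (Real.exp (r * (Real.exp t - 1))) := by
  have h := (NormedSpace.expSeries_div_hasSum_exp ((r : ℝ) * Real.exp t)).mul_left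
    (Real.exp (-r))
  rw [← Real.exp_eq_exp_ℝ, ← Real.exp_add] at h
  convert! h using 1
  · ext n
    rw [mul_pow, ← Real.exp_nat_mul]
    ring_nf
  · ring_nf

lemma integrable_exp_mul_poissonMeasure (r : NNReal) (t : ℝ) :
    Integrable (fun n : ℕ ↦ Real.exp (t * n)) (poissonMeasure r) := by
  rw [integrable_poissonMeasure_iff]
  simpa using (hasSum_exp_mul_poisson r t).summable

lemma integral_exp_mul_poissonMeasure (r : NNReal) (t : ℝ) :
    ∫ n : ℕ, Real.exp (t * n) ∂poissonMeasure r = Real.exp (r * (Real.exp t - 1)) := by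
  rw [integral_poissonMeasure]
  simpa using (hasSum_exp_mul_poisson r t).tsum_eq

lemma hasSum_natCast_mul_poisson (r : NNReal) :
    HasSum (fun n : ℕ ↦ Real.exp (-r) * (r : ℝ) ^ n / n.factorial * n) (r : ℝ) := by
  -- The term at 0 vanishes and `(n + 1) / (n + 1)! = 1 / n!`, so the shifted series is `r` times
  -- the total mass.
  rw [← hasSum_nat_add_iff' 1]
  have h := (hasSum_one_poissonMeasure r).mul_left (r : ℝ)
  convert! h using 1
  · ext n
    rw [Nat.factorial_succ]
    push_cast
    have : (n.factorial : ℝ) ≠ 0 := by positivity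
    field_simp
    ring
  · simp

lemma integrable_natCast_poissonMeasure (r : NNReal) :
    Integrable (fun n : ℕ ↦ (n : ℝ)) (poissonMeasure r) := by
  rw [integrable_poissonMeasure_iff]
  simpa using (hasSum_natCast_mul_poisson r).summable

lemma integral_natCast_poissonMeasure (r : NNReal) :
    ∫ n : ℕ, (n : ℝ) ∂poissonMeasure r = r := by
  rw [integral_poissonMeasure]
  simpa using (hasSum_natCast_mul_poisson r).tsum_eq

/-! ### Concentration of Poisson random variables -/

section HasLaw

variable {Ω : Type*} [MeasurableSpace Ω] {P : Measure Ω}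

lemma poisson_law_mgf {X : Ω → ℝ} {r : NNReal}
    (hX : HasLaw X ((poissonMeasure r).map (Nat.cast : ℕ → ℝ)) P) (t : ℝ) :
    Integrable (fun ω ↦ Real.exp (t * X ω)) P ∧ mgf X P t = Real.exp (r * (Real.exp t - 1)) := by
  have hm : Measurable fun x : ℝ ↦ Real.exp (t * x) := by fun_prop
  constructor
  · have := integrable_exp_mul_poissonMeasure r t
    have h2 : Integrable (fun x : ℝ ↦ Real.exp (t * x)) (P.map X) := by
      rw [hX.map_eq, integrable_map_measure hm.aestronglyMeasurable .of_discrete]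
      exact this
    exact h2.comp_aemeasurable hX.aemeasurable
  · rw [mgf, ← integral_exp_mul_poissonMeasure, ← integral_map (φ := (Nat.cast : ℕ → ℝ))
      (f := fun x ↦ Real.exp (t * x)) .of_discrete hm.aestronglyMeasurable, ← hX.map_eq,
      integral_map hX.aemeasurable hm.aestronglyMeasurable]

lemma poisson_law_mean {X : Ω → ℝ} {r : NNReal}
    (hX : HasLaw X ((poissonMeasure r).map (Nat.cast : ℕ → ℝ)) P) :
    Integrable X P ∧ ∫ ω, X ω ∂P = r := by
  have hm : Measurable fun x : ℝ ↦ x := measurable_id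
  constructor
  · have h2 : Integrable (fun x : ℝ ↦ x) (P.map X) := by
      rw [hX.map_eq, integrable_map_measure hm.aestronglyMeasurable .of_discrete]
      exact integrable_natCast_poissonMeasure r
    exact h2.comp_aemeasurable hX.aemeasurable
  · rw [← integral_natCast_poissonMeasure, ← integral_map (φ := (Nat.cast : ℕ → ℝ))
      (f := fun x ↦ x) .of_discrete hm.aestronglyMeasurable, ← hX.map_eq,
      integral_map hX.aemeasurable hm.aestronglyMeasurable]

/-- Chernoff bound for a Poisson random variable. -/
lemma poisson_law_tail [IsProbabilityMeasure P] {X : Ω → ℝ} {r : NNReal}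
    (hX : HasLaw X ((poissonMeasure r).map (Nat.cast : ℕ → ℝ)) P) {l : ℝ} (hl0 : 0 ≤ l)
    (hl1 : l ≤ 1) (a : ℝ) :
    P.real {ω | a ≤ |X ω - r|} ≤ 2 * Real.exp (-(l * a - r * l ^ 2)) := by
  have hr : (0 : ℝ) ≤ r := r.2
  have h1 := measure_ge_le_exp_mul_mgf (μ := P) (X := X) (r + a) hl0 (poisson_law_mgf hX l).1
  have h2 := measure_le_le_exp_mul_mgf (μ := P) (X := X) (r - a) (neg_nonpos.2 hl0)
    (poisson_law_mgf hX (-l)).1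
  rw [(poisson_law_mgf hX _).2, ← Real.exp_add] at h1 h2
  -- From `|exp x - 1 - x| ≤ x ^ 2` for `|x| ≤ 1`, used at `l` and `-l`; this is where `l ≤ 1`
  -- enters.
  have e1 := (abs_le.1 (Real.abs_exp_sub_one_sub_id_le (x := l) (by rwa [abs_of_nonneg hl0]))).2
  have e2 := (abs_le.1 (Real.abs_exp_sub_one_sub_id_le (x := -l)
    (by rwa [abs_neg, abs_of_nonneg hl0]))).2
  have b1 : -l * (r + a) + r * (Real.exp l - 1) ≤ -(l * a - r * l ^ 2) := by
    nlinarith [mul_le_mul_of_nonneg_left e1 hr]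
  have b2 : - -l * (r - a) + r * (Real.exp (-l) - 1) ≤ -(l * a - r * l ^ 2) := by
    nlinarith [mul_le_mul_of_nonneg_left e2 hr]
  have hsub : {ω | a ≤ |X ω - r|} ⊆ {ω | r + a ≤ X ω} ∪ {ω | X ω ≤ r - a} := by
    intro ω hω
    rcases le_abs.1 (show a ≤ |X ω - r| from hω) with h | h
    · left; show r + a ≤ X ω; linarith
    · right; show X ω ≤ r - a; linarith
  calc P.real {ω | a ≤ |X ω - r|}
      ≤ P.real ({ω | r + a ≤ X ω} ∪ {ω | X ω ≤ r - a}) := measureReal_mono hsub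
    _ ≤ _ := measureReal_union_le _ _
    _ ≤ Real.exp (-(l * a - r * l ^ 2)) + Real.exp (-(l * a - r * l ^ 2)) :=
        add_le_add (h1.trans (Real.exp_le_exp.2 b1)) (h2.trans (Real.exp_le_exp.2 b2))
    _ = _ := by ring

/-- Almost sure convergence of centred Poisson variables, from Chernoff bounds. -/
lemma poisson_ae_tendsto [IsProbabilityMeasure P] {X : ℕ → Ω → ℝ} {m : ℕ → NNReal} {b : ℕ → ℝ}
    (hX : ∀ n, HasLaw (X n) ((poissonMeasure (m n)).map (Nat.cast : ℕ → ℝ)) P)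
    (hb : ∀ᶠ n in atTop, 0 < b n)
    (h : ∀ η : ℝ, 0 < η → ∃ l : ℕ → ℝ, ∀ᶠ n : ℕ in atTop, 0 ≤ l n ∧ l n ≤ 1 ∧
      2 * Real.log n ≤ l n * (η * b n) - m n * l n ^ 2) :
    ∀ᵐ ω ∂P, Tendsto (fun n ↦ (X n ω - m n) / b n) atTop (𝓝 0) := by
  -- Countably many accuracies `1 / (k + 1)` suffice, so the exceptional null sets can be united.
  have key : ∀ k : ℕ, ∀ᵐ ω ∂P, ∀ᶠ n in atTop,
      ω ∉ {ω | 1 / ((k : ℝ) + 1) * b n ≤ |X n ω - m n|} := by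
    intro k
    apply ae_eventually_notMem
    obtain ⟨l, hl⟩ := h (1 / ((k : ℝ) + 1)) (by positivity)
    have hs : Summable fun n : ℕ ↦ P.real {ω | 1 / ((k : ℝ) + 1) * b n ≤ |X n ω - m n|} := by
      refine Summable.of_norm_bounded_eventually_nat (g := fun n : ℕ ↦ 2 * (1 / (n : ℝ) ^ 2))
        ((Real.summable_one_div_nat_pow.2 one_lt_two).mul_left 2) ?_
      filter_upwards [hl, eventually_gt_atTop 0] with n hn hn0
      rw [Real.norm_of_nonneg measureReal_nonneg]
      refine (poisson_law_tail (hX n) hn.1 hn.2.1 _).trans ?_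
      gcongr
      have hn0' : (0 : ℝ) < n := by exact_mod_cast hn0
      rw [← Real.log_le_log_iff (Real.exp_pos _) (by positivity), Real.log_exp,
        one_div ((n : ℝ) ^ 2), Real.log_inv, Real.log_pow]
      push_cast
      linarith [hn.2.2]
    have := hs.tsum_ofReal_ne_top
    simpa [measureReal_def, ENNReal.ofReal_toReal (measure_ne_top P _)] using this
  filter_upwards [ae_all_iff.2 key] with ω hω
  rw [Metric.tendsto_nhds]
  intro e he
  obtain ⟨k, hk⟩ := exists_nat_one_div_lt he
  filter_upwards [hω k, hb] with n hn hbn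
  replace hn := not_le.1 hn
  rw [dist_zero_right, norm_div, Real.norm_eq_abs, Real.norm_of_nonneg hbn.le, div_lt_iff₀ hbn]
  exact hn.trans (mul_lt_mul_of_pos_right hk hbn)

lemma hasLaw_toNat_of_map_eq {c : Ω → ℕ∞} {r : NNReal} (hc : Measurable c)
    (h : P.map c = (poissonMeasure r).map (fun k : ℕ ↦ (k : ℕ∞))) :
    (∀ᵐ ω ∂P, c ω ≠ ⊤) ∧
      HasLaw (fun ω ↦ ((c ω).toNat : ℝ)) ((poissonMeasure r).map (Nat.cast : ℕ → ℝ)) P := by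
  have hf : Measurable fun x : ℕ∞ ↦ (x.toNat : ℝ) := .of_discrete
  constructor
  · have : ∀ᵐ x ∂(P.map c), x ≠ ⊤ := by
      rw [h, ae_map_iff .of_discrete (MeasurableSet.of_discrete)]
      simp
    exact ae_of_ae_map hc.aemeasurable this
  · refine ⟨(hf.comp hc).aemeasurable, ?_⟩
    have := congrArg (Measure.map fun x : ℕ∞ ↦ (x.toNat : ℝ)) h
    rw [Measure.map_map hf hc, Measure.map_map hf .of_discrete] at this
    exact this

end HasLaw

/-! ### Geometry of the covering ellipses -/

namespace EllipsesModel

lemma volume_rotated_box (v L h : ℝ) :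
    volume {z : Plane | |Real.cos v * z 0 + Real.sin v * z 1| ≤ L ∧
      |-Real.sin v * z 0 + Real.cos v * z 1| ≤ h} =
      ENNReal.ofReal (2 * L) * ENNReal.ofReal (2 * h) := by
  set M : Matrix (Fin 2) (Fin 2) ℝ := !![Real.cos v, Real.sin v; -Real.sin v, Real.cos v] with hM
  have hdet : M.det = 1 := by
    rw [hM, Matrix.det_fin_two_of]
    nlinarith [Real.sin_sq_add_cos_sq v]
  set B : Set (Fin 2 → ℝ) := Set.univ.pi ![Set.Icc (-L) L, Set.Icc (-h) h] with hB
  have hBm : MeasurableSet B := by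
    refine MeasurableSet.univ_pi fun i ↦ ?_
    fin_cases i <;> exact measurableSet_Icc
  have hset : {z : Plane | |Real.cos v * z 0 + Real.sin v * z 1| ≤ L ∧
      |-Real.sin v * z 0 + Real.cos v * z 1| ≤ h} =
      (WithLp.ofLp : Plane → Fin 2 → ℝ) ⁻¹' (Matrix.toLin' M ⁻¹' B) := by
    ext z
    simp [hB, hM, Set.mem_pi, Fin.forall_fin_two, abs_le, dotProduct,
      Fin.sum_univ_two]
  have hML : Measurable (Matrix.toLin' M) :=
    (LinearMap.continuous_of_finiteDimensional _).measurable
  rw [hset, (PiLp.volume_preserving_ofLp (Fin 2)).measure_preimage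
    (hML hBm).nullMeasurableSet, ← Measure.map_apply hML hBm,
    Real.map_matrix_volume_pi_eq_smul_volume_pi (by rw [hdet]; exact one_ne_zero), hdet]
  simp only [inv_one, abs_one, ENNReal.ofReal_one, one_smul]
  rw [hB, volume_pi_pi, Fin.prod_univ_two]
  simp only [Matrix.cons_val_zero, Matrix.cons_val_one, Real.volume_Icc]
  ring_nf

instance : IsProbabilityMeasure directionLaw := by
  constructor
  rw [directionLaw, Measure.smul_apply, comap_subtype_coe_apply measurableSet_Ioc]
  simp only [Set.image_univ, Subtype.range_coe, Real.volume_Ioc, smul_eq_mul]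
  rw [← ENNReal.ofReal_mul (by positivity)]
  have := Real.pi_ne_zero
  rw [show Real.pi⁻¹ * (Real.pi / 2 - -(Real.pi / 2)) = 1 by field_simp; ring]
  simp

/-- Parameters of ellipses centred in `B(n)` and covering `B(ε)`. -/
def coveringSet (ε : ℝ) (n : ℕ) : Set Params :=
  {s | Metric.closedBall (0 : Plane) ε ⊆ ellipse s ∧
    center s ∈ Metric.closedBall (0 : Plane) (n : ℝ)}

lemma isClosed_mem_ellipse (p : Plane) : IsClosed {s : Params | p ∈ ellipse s} := by
  have hR : ∀ s : Params, (s.2.1 : ℝ) ≠ 0 := fun s ↦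
    (zero_lt_one.trans_le (show (1 : ℝ) ≤ s.2.1 from s.2.1.2)).ne'
  have hc : Continuous fun s : Params ↦
      ((Real.cos s.2.2 * (p 0 - s.1 0) + Real.sin s.2.2 * (p 1 - s.1 1)) / (s.2.1 : ℝ)) ^ 2
      + (-Real.sin s.2.2 * (p 0 - s.1 0) + Real.cos s.2.2 * (p 1 - s.1 1)) ^ 2 :=
    ((Continuous.div (by fun_prop) (by fun_prop) hR).pow 2).add (by fun_prop)
  exact isClosed_le hc continuous_const

lemma isClosed_coveringSet (ε : ℝ) (n : ℕ) : IsClosed (coveringSet ε n) := by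
  have h : coveringSet ε n = (⋂ p ∈ Metric.closedBall (0 : Plane) ε, {s : Params | p ∈ ellipse s}) ∩
      center ⁻¹' Metric.closedBall 0 n := by
    ext s
    simp [coveringSet, Set.subset_def]
  rw [h]
  exact (isClosed_biInter fun p _ ↦ isClosed_mem_ellipse p).inter
    (Metric.isClosed_closedBall.preimage continuous_fst)

lemma rotated_sq_add_sq (v : ℝ) (z : Plane) :
    (Real.cos v * z 0 + Real.sin v * z 1) ^ 2 + (-Real.sin v * z 0 + Real.cos v * z 1) ^ 2 =
      ‖z‖ ^ 2 := by
  rw [EuclideanSpace.real_norm_sq_eq, Fin.sum_univ_two]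
  linear_combination (z 0 ^ 2 + z 1 ^ 2) * Real.sin_sq_add_cos_sq v

/-- Covering the origin bounds the rotated coordinates of the centre by `R` and 1; the norm bound on
the centre gives the truncation at `n`. -/
lemma section_coveringSet_subset {ε : ℝ} (hε : 0 ≤ ε) (n : ℕ)
    (y : Set.Ici (1 : ℝ) × Set.Ioc (-(Real.pi / 2)) (Real.pi / 2)) :
    (fun z ↦ ((z, y) : Params)) ⁻¹' coveringSet ε n ⊆
      {z : Plane | |Real.cos y.2 * z 0 + Real.sin y.2 * z 1| ≤ min (y.1 : ℝ) n ∧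
        |-Real.sin y.2 * z 0 + Real.cos y.2 * z 1| ≤ 1} := by
  rintro z ⟨hz, hzn⟩
  have h0 := hz (Metric.mem_closedBall_self hε)
  replace hzn : ‖z‖ ≤ n := by simpa [center] using hzn
  have hR : (0 : ℝ) < y.1 := zero_lt_one.trans_le y.1.2
  have hsq := rotated_sq_add_sq y.2 z
  simp only [ellipse, Set.mem_ofPred_eq, PiLp.zero_apply, zero_sub] at h0
  set a := Real.cos y.2 * z 0 + Real.sin y.2 * z 1 with ha
  set b := -Real.sin y.2 * z 0 + Real.cos y.2 * z 1 with hb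
  have h1 : (a / y.1) ^ 2 + b ^ 2 ≤ 1 := by
    convert! h0 using 1
    rw [ha, hb]; ring
  refine ⟨le_min ?_ ?_, ?_⟩
  · have : |a / y.1| ≤ 1 := by
      rw [← sq_le_one_iff_abs_le_one]; nlinarith [sq_nonneg b]
    rwa [abs_div, abs_of_pos hR, div_le_one hR] at this
  · refine abs_le_of_sq_le_sq ?_ n.cast_nonneg
    nlinarith [sq_nonneg b, norm_nonneg z]
  · rw [← sq_le_one_iff_abs_le_one]; nlinarith [sq_nonneg (a / (y.1 : ℝ))]

/-- The factor `1 / 5` leaves room for `ε`: since `R ≥ 1`, both normalised coordinates of `p - z`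
are at most `1 / 2 + 1 / 5 = 7 / 10`, and `2 * (7 / 10) ^ 2 < 1`. -/
lemma subset_section_coveringSet {ε : ℝ} (hε : ε < 1 / 2) {n : ℕ} (hn : 1 ≤ n)
    (y : Set.Ici (1 : ℝ) × Set.Ioc (-(Real.pi / 2)) (Real.pi / 2)) :
    {z : Plane | |Real.cos y.2 * z 0 + Real.sin y.2 * z 1| ≤ min (y.1 : ℝ) n / 5 ∧
        |-Real.sin y.2 * z 0 + Real.cos y.2 * z 1| ≤ 1 / 5} ⊆
      (fun z ↦ ((z, y) : Params)) ⁻¹' coveringSet ε n := by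
  rintro z ⟨hza, hzb⟩
  have hR1 : (1 : ℝ) ≤ y.1 := y.1.2
  have hn1 : (1 : ℝ) ≤ n := by exact_mod_cast hn
  have hsq := rotated_sq_add_sq y.2 z
  have hzR := hza.trans (div_le_div_of_nonneg_right (min_le_left _ _) (by norm_num))
  have hzn := hza.trans (div_le_div_of_nonneg_right (min_le_right _ _) (by norm_num))
  constructor
  · intro p hp
    have hp1 : ‖p‖ ≤ 1 / 2 := (mem_closedBall_zero_iff.1 hp).trans hε.le
    have hpsq := rotated_sq_add_sq y.2 p
    have hp2 : ‖p‖ ^ 2 ≤ (1 / 2) ^ 2 := by gcongr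
    have hpa : |Real.cos y.2 * p 0 + Real.sin y.2 * p 1| ≤ 1 / 2 :=
      abs_le_of_sq_le_sq (by nlinarith [sq_nonneg (-Real.sin y.2 * p 0 + Real.cos y.2 * p 1)])
        (by norm_num)
    have hpb : |-Real.sin y.2 * p 0 + Real.cos y.2 * p 1| ≤ 1 / 2 :=
      abs_le_of_sq_le_sq (by nlinarith [sq_nonneg (Real.cos y.2 * p 0 + Real.sin y.2 * p 1)])
        (by norm_num)
    rw [abs_le] at *
    have hA : |(Real.cos y.2 * (p 0 - z 0) + Real.sin y.2 * (p 1 - z 1)) / (y.1 : ℝ)| ≤ 7 / 10 := by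
      rw [abs_div, abs_of_pos (by linarith : (0 : ℝ) < y.1), div_le_iff₀ (by linarith), abs_le]
      constructor <;> linarith
    have hB : |-Real.sin y.2 * (p 0 - z 0) + Real.cos y.2 * (p 1 - z 1)| ≤ 7 / 10 := by
      rw [abs_le]
      constructor <;> linarith
    have hA2 := sq_le_sq' (abs_le.1 hA).1 (abs_le.1 hA).2
    have hB2 := sq_le_sq' (abs_le.1 hB).1 (abs_le.1 hB).2
    show _ + _ ≤ (1 : ℝ)
    refine (add_le_add hA2 hB2).trans (by norm_num)
  · show z ∈ Metric.closedBall (0 : Plane) n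
    rw [mem_closedBall_zero_iff]
    refine le_of_sq_le_sq ?_ (by linarith)
    have hA2 := sq_le_sq' (abs_le.1 hzn).1 (abs_le.1 hzn).2
    have hB2 := sq_le_sq' (abs_le.1 hzb).1 (abs_le.1 hzb).2
    nlinarith

lemma lintegral_prod_directionLaw (ρ : Measure (Set.Ici (1 : ℝ))) [SFinite ρ]
    {f : Set.Ici (1 : ℝ) → ENNReal} (hf : Measurable f) :
    ∫⁻ y, f y.1 ∂(ρ.prod directionLaw) = ∫⁻ R, f R ∂ρ :=
  measurePreserving_fst.lintegral_comp hf

/-! ### The mean count as a truncated moment of `ρ` -/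

section Intensity

variable (ρ : Measure (Set.Ici (1 : ℝ))) [IsProbabilityMeasure ρ]

lemma integrable_min (n : ℕ) : Integrable (fun R : Set.Ici (1 : ℝ) ↦ min (R : ℝ) n) ρ := by
  refine Integrable.of_bound (by fun_prop) n (ae_of_all _ fun R ↦ ?_)
  have hR : (1 : ℝ) ≤ R := R.2
  rw [Real.norm_of_nonneg (le_min (by linarith) n.cast_nonneg)]
  exact min_le_right _ _

lemma min_nonneg_of_Ici (n : ℕ) (R : Set.Ici (1 : ℝ)) : 0 ≤ min (R : ℝ) n :=
  le_min (zero_le_one.trans R.2) n.cast_nonneg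

lemma lintegral_const_mul_min {c : ℝ} (hc : 0 ≤ c) (n : ℕ) :
    ∫⁻ y, ENNReal.ofReal (c * min (y.1 : ℝ) n) ∂(ρ.prod directionLaw) =
      ENNReal.ofReal (c * ∫ R, min (R : ℝ) n ∂ρ) := by
  rw [lintegral_prod_directionLaw ρ (f := fun R ↦ ENNReal.ofReal (c * min (R : ℝ) n))
    (by fun_prop), ← integral_const_mul, ofReal_integral_eq_lintegral_ofReal
    ((integrable_min ρ n).const_mul c)
    (ae_of_all _ fun R ↦ mul_nonneg hc (min_nonneg_of_Ici n R))]

variable {u ε : ℝ}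

lemma intensity_coveringSet (n : ℕ) : intensity u ρ (coveringSet ε n) =
    ∫⁻ y, ENNReal.ofReal u * volume ((fun z ↦ ((z, y) : Params)) ⁻¹' coveringSet ε n)
      ∂(ρ.prod directionLaw) := by
  rw [intensity, Measure.prod_apply_symm (isClosed_coveringSet ε n).measurableSet]
  rfl

lemma intensity_coveringSet_le (hu : 0 ≤ u) (hε : 0 ≤ ε) (n : ℕ) :
    intensity u ρ (coveringSet ε n) ≤ ENNReal.ofReal (4 * u * ∫ R, min (R : ℝ) n ∂ρ) := by
  rw [intensity_coveringSet, ← lintegral_const_mul_min ρ (by positivity)]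
  refine lintegral_mono fun y ↦ ?_
  calc _ ≤ _ := mul_le_mul_right (measure_mono (section_coveringSet_subset hε n y)) _
    _ = _ := by
      have := min_nonneg_of_Ici n y.1
      rw [volume_rotated_box, ← ENNReal.ofReal_mul (by positivity), ← ENNReal.ofReal_mul hu]
      ring_nf

lemma le_intensity_coveringSet (hu : 0 ≤ u) (hε : ε < 1 / 2) {n : ℕ} (hn : 1 ≤ n) :
    ENNReal.ofReal (4 * u / 25 * ∫ R, min (R : ℝ) n ∂ρ) ≤ intensity u ρ (coveringSet ε n) := by
  rw [intensity_coveringSet, ← lintegral_const_mul_min ρ (by positivity)]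
  refine lintegral_mono fun y ↦ ?_
  calc _ = _ := by
        have := min_nonneg_of_Ici n y.1
        rw [show 4 * u / 25 * min (y.1 : ℝ) n = u * (2 * (min (y.1 : ℝ) n / 5) * (2 * (1 / 5))) by
          ring, ENNReal.ofReal_mul hu, ENNReal.ofReal_mul (by positivity), ← volume_rotated_box]
    _ ≤ _ := mul_le_mul_right (measure_mono (subset_section_coveringSet hε hn y)) _

end Intensity

/-! ### Growth of the truncated moment -/

section Tail

variable (ρ : Measure (Set.Ici (1 : ℝ))) [IsProbabilityMeasure ρ]

lemma antitone_tail : Antitone fun r : ℝ ↦ ρ.real {R | r ≤ (R : ℝ)} :=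
  fun _ _ h ↦ measureReal_mono fun _ hR ↦ h.trans hR

/-- Layer-cake formula: up to level `n`, `min R n` and `R` have the same tail. The split at 1 is
made because tail decay is assumed only for `r ≥ 1`. -/
lemma integral_min_eq (n : ℕ) :
    ∫ R, min (R : ℝ) n ∂ρ = (∫ r in (0 : ℝ)..1, ρ.real {R | r ≤ (R : ℝ)}) +
      ∫ r in (1 : ℝ)..n, ρ.real {R | r ≤ (R : ℝ)} := by
  have hi : ∀ a b : ℝ, IntervalIntegrable (fun r : ℝ ↦ ρ.real {R | r ≤ (R : ℝ)}) volume a b :=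
    fun a b ↦ (antitone_tail ρ).intervalIntegrable
  rw [intervalIntegral.integral_add_adjacent_intervals (hi _ _) (hi _ _),
    intervalIntegral.integral_of_le n.cast_nonneg,
    (integrable_min ρ n).integral_eq_integral_Ioc_meas_le (M := n)
      (ae_of_all _ (min_nonneg_of_Ici n)) (ae_of_all _ fun R ↦ min_le_right _ _)]
  refine setIntegral_congr_fun measurableSet_Ioc fun t ht ↦ ?_
  simp [ht.2]

lemma integral_min_bounds {C α : ℝ} (hC : ∀ r : ℝ, 1 ≤ r →
      C⁻¹ * r ^ (-α) ≤ ρ.real {R | r ≤ (R : ℝ)} ∧ ρ.real {R | r ≤ (R : ℝ)} ≤ C * r ^ (-α))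
    {n : ℕ} (hn : 1 ≤ n) :
    C⁻¹ * ∫ r in (1 : ℝ)..n, r ^ (-α) ≤ ∫ R, min (R : ℝ) n ∂ρ ∧
      ∫ R, min (R : ℝ) n ∂ρ ≤ 1 + C * ∫ r in (1 : ℝ)..n, r ^ (-α) := by
  have hn1 : (1 : ℝ) ≤ n := by exact_mod_cast hn
  have hi : ∀ a b : ℝ, IntervalIntegrable (fun r : ℝ ↦ ρ.real {R | r ≤ (R : ℝ)}) volume a b :=
    fun a b ↦ (antitone_tail ρ).intervalIntegrable
  have hp : IntervalIntegrable (fun r : ℝ ↦ r ^ (-α)) volume 1 n := by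
    refine intervalIntegral.intervalIntegrable_rpow (Or.inr ?_)
    rw [Set.uIcc_of_le hn1]
    exact fun h ↦ absurd h.1 (by norm_num)
  rw [integral_min_eq ρ n, ← intervalIntegral.integral_const_mul,
    ← intervalIntegral.integral_const_mul]
  have h0 : 0 ≤ ∫ r in (0 : ℝ)..1, ρ.real {R | r ≤ (R : ℝ)} :=
    intervalIntegral.integral_nonneg zero_le_one fun _ _ ↦ measureReal_nonneg
  have h1 : ∫ r in (0 : ℝ)..1, ρ.real {R | r ≤ (R : ℝ)} ≤ 1 := by
    have := intervalIntegral.integral_mono_on (μ := volume) zero_le_one (hi 0 1)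
      (intervalIntegrable_const (c := (1 : ℝ))) fun x _ ↦ measureReal_le_one
    simpa using this
  have h2 := intervalIntegral.integral_mono_on hn1 (hp.const_mul C⁻¹) (hi 1 n)
    fun x hx ↦ (hC x hx.1).1
  have h3 := intervalIntegral.integral_mono_on hn1 (hi 1 n) (hp.const_mul C)
    fun x hx ↦ (hC x hx.1).2
  constructor <;> linarith

lemma integral_min_asymp_of_lt_one {α : ℝ} (hρ : HasTailDecay ρ α) (hα : α < 1) :
    ∃ c C : ℝ, 0 < c ∧ 0 < C ∧ ∀ᶠ n : ℕ in atTop, c * (n : ℝ) ^ (1 - α) ≤ ∫ R, min (R : ℝ) n ∂ρ ∧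
      ∫ R, min (R : ℝ) n ∂ρ ≤ C * (n : ℝ) ^ (1 - α) := by
  obtain ⟨C, hC0, hC⟩ := hρ
  have hα' : 0 < 1 - α := by linarith
  refine ⟨C⁻¹ / (2 * (1 - α)), 1 + C / (1 - α), by positivity, by positivity, ?_⟩
  have ht := (tendsto_rpow_atTop hα').comp (tendsto_natCast_atTop_atTop (R := ℝ))
  -- With `x = n ^ (1 - α) ≥ 2`, one has `x - 1 ≥ x / 2` for the lower bound, and `x` absorbs the
  -- additive 1 in the upper one.
  filter_upwards [eventually_ge_atTop 1, ht.eventually_ge_atTop 2] with n hn hn2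
  have hn1 : (1 : ℝ) ≤ n := by exact_mod_cast hn
  replace hn2 : 2 ≤ (n : ℝ) ^ (1 - α) := hn2
  obtain ⟨h1, h2⟩ := integral_min_bounds ρ hC hn
  rw [integral_rpow (Or.inl (by linarith)), Real.one_rpow, neg_add_eq_sub] at h1 h2
  constructor
  · refine le_trans ?_ h1
    rw [div_mul_eq_mul_div, mul_div_assoc]
    refine mul_le_mul_of_nonneg_left ?_ (by positivity)
    rw [div_le_div_iff₀ (by positivity) (by positivity)]
    nlinarith
  · refine h2.trans ?_
    have : ((n : ℝ) ^ (1 - α) - 1) / (1 - α) ≤ (n : ℝ) ^ (1 - α) / (1 - α) := by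
      gcongr; linarith
    have := mul_le_mul_of_nonneg_left this hC0.le
    calc _ ≤ (n : ℝ) ^ (1 - α) + C * ((n : ℝ) ^ (1 - α) / (1 - α)) := by linarith
      _ = _ := by ring

lemma integral_min_asymp_of_eq_one (hρ : HasTailDecay ρ 1) :
    ∃ c C : ℝ, 0 < c ∧ 0 < C ∧ ∀ᶠ n : ℕ in atTop, c * Real.log n ≤ ∫ R, min (R : ℝ) n ∂ρ ∧
      ∫ R, min (R : ℝ) n ∂ρ ≤ C * Real.log n := by
  obtain ⟨C, hC0, hC⟩ := hρ
  refine ⟨C⁻¹, 1 + C, by positivity, by positivity, ?_⟩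
  have ht := Real.tendsto_log_atTop.comp (tendsto_natCast_atTop_atTop (R := ℝ))
  filter_upwards [eventually_ge_atTop 1, ht.eventually_ge_atTop 1] with n hn hn2
  have hn1 : (0 : ℝ) < n := by exact_mod_cast hn
  replace hn2 : 1 ≤ Real.log n := hn2
  obtain ⟨h1, h2⟩ := integral_min_bounds ρ hC hn
  simp only [Real.rpow_neg_one] at h1 h2
  rw [integral_inv_of_pos one_pos hn1, div_one] at h1 h2
  exact ⟨h1, by linarith⟩

end Tail

/-! ### Choice of the Chernoff parameter -/

lemma isTheta_of_eventually_bounds {f g : ℕ → ℝ} {c C : ℝ} (hc : 0 < c)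
    (hg : ∀ᶠ n in atTop, 0 ≤ g n) (h : ∀ᶠ n in atTop, c * g n ≤ f n ∧ f n ≤ C * g n) :
    f =Θ[atTop] g := by
  constructor
  · refine Asymptotics.IsBigO.of_bound C ?_
    filter_upwards [hg, h] with n h0 h1
    rw [Real.norm_of_nonneg h0, Real.norm_of_nonneg ((mul_nonneg hc.le h0).trans h1.1)]
    exact h1.2
  · refine Asymptotics.IsBigO.of_bound c⁻¹ ?_
    filter_upwards [hg, h] with n h0 h1
    rw [Real.norm_of_nonneg h0, Real.norm_of_nonneg ((mul_nonneg hc.le h0).trans h1.1),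
      inv_mul_eq_div, le_div_iff₀' hc]
    exact h1.1

lemma chernoff_rate_of_lt_one {α δ C η : ℝ} (hα : α < 1) (hδ : 0 < δ) (hC : 0 < C) (hη : 0 < η)
    {m : ℕ → NNReal} (hm : ∀ᶠ n in atTop, (m n : ℝ) ≤ C * (n : ℝ) ^ (1 - α)) :
    ∃ l : ℕ → ℝ, ∀ᶠ n : ℕ in atTop, 0 ≤ l n ∧ l n ≤ 1 ∧ 2 * Real.log n ≤
      l n * (η * √((n : ℝ) ^ (1 - α) * (Real.log n) ^ (1 + δ))) - m n * l n ^ 2 := by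
  have ho := (isLittleO_log_rpow_rpow_atTop (1 + δ) (sub_pos.2 hα)).comp_tendsto
    (tendsto_natCast_atTop_atTop (R := ℝ))
  have hL := Real.tendsto_log_atTop.comp (tendsto_natCast_atTop_atTop (R := ℝ))
  have hLδ := (tendsto_rpow_atTop hδ).comp hL
  set κ := η / (2 * C) with hκ
  have hκ0 : 0 < κ := by positivity
  -- With `x = n ^ (1 - α)` and `y = (log n) ^ (1 + δ)`, this maximises `l * η * √(x * y) - C * x *
  -- l ^ 2`. The maximum `η ^ 2 / (4 * C) * y` beats `2 * log n` because `δ > 0`, and `l ≤ 1`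
  -- eventually because `y = o(x)`.
  refine ⟨fun n ↦ κ * √((Real.log n) ^ (1 + δ) / (n : ℝ) ^ (1 - α)), ?_⟩
  filter_upwards [hm, ho.bound (c := (κ⁻¹) ^ 2) (by positivity), hL.eventually_ge_atTop 1,
    hLδ.eventually_ge_atTop (8 * C / η ^ 2), eventually_gt_atTop 0] with n hmn hon hLn hLδn hn
  have hn0 : (0 : ℝ) < n := by exact_mod_cast hn
  simp only [Function.comp_apply] at hon hLn hLδn
  have hLpos : 0 < Real.log n := by linarith
  have hY : (Real.log n) ^ (1 + δ) = Real.log n * (Real.log n) ^ δ := by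
    rw [Real.rpow_add hLpos, Real.rpow_one]
  have hx : 0 < (n : ℝ) ^ (1 - α) := by positivity
  have hy : 0 < (Real.log n) ^ (1 + δ) := by positivity
  set x := (n : ℝ) ^ (1 - α)
  set y := (Real.log n) ^ (1 + δ)
  rw [Real.norm_of_nonneg hx.le, Real.norm_of_nonneg hy.le] at hon
  have hsx : √(y / x) * √(x * y) = y := by
    rw [← Real.sqrt_mul (by positivity), show y / x * (x * y) = y ^ 2 by field_simp,
      Real.sqrt_sq hy.le]
  have hs2 : √(y / x) ^ 2 = y / x := Real.sq_sqrt (by positivity)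
  refine ⟨by positivity, ?_, ?_⟩
  · rw [← le_div_iff₀' hκ0, Real.sqrt_le_left (by positivity), div_le_iff₀ hx, one_div]
    exact hon
  · have e1 : κ * √(y / x) * (η * √(x * y)) = κ * η * y := by
      linear_combination κ * η * hsx
    have e2 : m n * (κ * √(y / x)) ^ 2 ≤ C * κ ^ 2 * y := by
      rw [mul_pow, hs2]
      calc (m n : ℝ) * (κ ^ 2 * (y / x)) ≤ C * x * (κ ^ 2 * (y / x)) := by gcongr
        _ = _ := by field_simp
    have e3 : κ * η * y - C * κ ^ 2 * y = η ^ 2 / (4 * C) * y := by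
      rw [hκ]; field_simp; ring
    have e4 : 2 * Real.log n ≤ η ^ 2 / (4 * C) * y := by
      rw [hY]
      calc 2 * Real.log n = η ^ 2 / (4 * C) * (Real.log n * (8 * C / η ^ 2)) := by
            field_simp; ring
        _ ≤ _ := by gcongr
    linarith

lemma chernoff_rate_of_eq_one {δ C η : ℝ} (hδ : 0 < δ) (hη : 0 < η)
    {m : ℕ → NNReal} (hm : ∀ᶠ n in atTop, (m n : ℝ) ≤ C * Real.log n) :
    ∃ l : ℕ → ℝ, ∀ᶠ n : ℕ in atTop, 0 ≤ l n ∧ l n ≤ 1 ∧ 2 * Real.log n ≤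
      l n * (η * ((n : ℝ) ^ (1 / 2 : ℝ) * (Real.log n) ^ (1 + δ))) - m n * l n ^ 2 := by
  have hL := Real.tendsto_log_atTop.comp (tendsto_natCast_atTop_atTop (R := ℝ))
  have hs := (tendsto_rpow_atTop (one_half_pos (α := ℝ))).comp
    (tendsto_natCast_atTop_atTop (R := ℝ))
  -- No optimisation is needed: the normaliser is polynomially large while the mean is only
  -- logarithmic.
  refine ⟨fun _ ↦ 1, ?_⟩
  filter_upwards [hm, hL.eventually_ge_atTop 1, hs.eventually_ge_atTop ((C + 2) / η)]
    with n hmn hLn hsn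
  simp only [Function.comp_apply] at hLn hsn
  refine ⟨zero_le_one, le_rfl, ?_⟩
  rw [div_le_iff₀' hη] at hsn
  have h1 : Real.log n ≤ (Real.log n) ^ (1 + δ) :=
    Real.self_le_rpow_of_one_le hLn (by linarith)
  have h2 : (C + 2) * Real.log n ≤ η * ((n : ℝ) ^ (1 / 2 : ℝ) * (Real.log n) ^ (1 + δ)) := by
    calc (C + 2) * Real.log n ≤ η * (n : ℝ) ^ (1 / 2 : ℝ) * Real.log n := by gcongr
      _ ≤ η * (n : ℝ) ^ (1 / 2 : ℝ) * (Real.log n) ^ (1 + δ) := by gcongr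
      _ = _ := by ring
  linarith

/-! ### Law and mean of the covering count -/

section Counting

variable {Ω : Type*} [MeasurableSpace Ω] {P : Measure Ω} {u ε : ℝ}
  {ρ : Measure (Set.Ici (1 : ℝ))} [IsProbabilityMeasure ρ] {Ξ : Ω → Set Params}

lemma numCovering_law (hu : 0 ≤ u) (hε : 0 ≤ ε) (hΞ : IsEllipsesModel Ξ u ρ P) (n : ℕ) :
    (∀ᵐ ω ∂P, numCovering (Ξ ω) ε n ≠ ⊤) ∧
      HasLaw (fun ω ↦ ((numCovering (Ξ ω) ε n).toNat : ℝ))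
        ((poissonMeasure (intensity u ρ (coveringSet ε n)).toNNReal).map (Nat.cast : ℕ → ℝ)) P :=
  have hA := (isClosed_coveringSet ε n).measurableSet
  hasLaw_toNat_of_map_eq (hΞ.measurable_count _ hA)
    (hΞ.map_count _ hA ((intensity_coveringSet_le ρ hu hε n).trans_lt ENNReal.ofReal_lt_top).ne)

lemma mean_bounds (hu : 0 < u) (hε₀ : 0 ≤ ε) (hε : ε < 1 / 2) {g : ℕ → ℝ}
    (h : ∃ c C : ℝ, 0 < c ∧ 0 < C ∧ ∀ᶠ n : ℕ in atTop, c * g n ≤ ∫ R, min (R : ℝ) n ∂ρ ∧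
      ∫ R, min (R : ℝ) n ∂ρ ≤ C * g n) :
    ∃ c C : ℝ, 0 < c ∧ 0 < C ∧ ∀ᶠ n : ℕ in atTop,
      c * g n ≤ (intensity u ρ (coveringSet ε n)).toNNReal ∧
      ((intensity u ρ (coveringSet ε n)).toNNReal : ℝ) ≤ C * g n := by
  obtain ⟨c, C, hc, hC, h⟩ := h
  refine ⟨4 * u / 25 * c, 4 * u * C, by positivity, by positivity, ?_⟩
  filter_upwards [h, eventually_ge_atTop 1] with n h hn
  have hle := intensity_coveringSet_le ρ hu.le hε₀ n
  have hJ : 0 ≤ ∫ R, min (R : ℝ) n ∂ρ := integral_nonneg (min_nonneg_of_Ici n)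
  rw [ENNReal.coe_toNNReal_eq_toReal]
  constructor
  · have := (ENNReal.ofReal_le_iff_le_toReal (hle.trans_lt ENNReal.ofReal_lt_top).ne).1
      (le_intensity_coveringSet ρ hu.le hε hn)
    refine le_trans ?_ this
    rw [mul_assoc (4 * u / 25)]
    exact mul_le_mul_of_nonneg_left h.1 (by positivity)
  · refine (ENNReal.toReal_le_of_le_ofReal (by positivity) hle).trans ?_
    rw [mul_assoc (4 * u)]
    exact mul_le_mul_of_nonneg_left h.2 (by positivity)

end Counting

end EllipsesModel

theorem mainTheorem10 {Ω : Type*} [MeasurableSpace Ω] (P : Measure Ω) [IsProbabilityMeasure P]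
    (u α : ℝ) (hu : 0 < u) (hα : 0 < α)
    (ρ : Measure (Set.Ici (1 : ℝ))) [IsProbabilityMeasure ρ]
    (hρ : EllipsesModel.HasTailDecay ρ α)
    (Ξ : Ω → Set EllipsesModel.Params) (hΞ : EllipsesModel.IsEllipsesModel Ξ u ρ P)
    (ε : ℝ) (hε₀ : 0 ≤ ε) (hε : ε < 1 / 2)
    (N : ℕ → Ω → ℝ)
    (hN : ∀ n ω, N n ω = ((EllipsesModel.numCovering (Ξ ω) ε n).toNat : ℝ)) :
    (∀ n : ℕ, (∀ᵐ ω ∂P, EllipsesModel.numCovering (Ξ ω) ε n ≠ ⊤) ∧ Integrable (N n) P) ∧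
    (α < 1 →
      ((fun n : ℕ ↦ ∫ ω, N n ω ∂P) =Θ[atTop] fun n : ℕ ↦ (n : ℝ) ^ (1 - α)) ∧
      ∀ δ : ℝ, 0 < δ → ∀ᵐ ω ∂P, Tendsto
        (fun n : ℕ ↦ (N n ω - ∫ ω', N n ω' ∂P) /
          √((n : ℝ) ^ (1 - α) * (Real.log n) ^ (1 + δ)))
        atTop (𝓝 0)) ∧
    (α = 1 →
      ((fun n : ℕ ↦ ∫ ω, N n ω ∂P) =Θ[atTop] fun n : ℕ ↦ Real.log n) ∧
      ∀ δ : ℝ, 0 < δ → ∀ᵐ ω ∂P, Tendsto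
        (fun n : ℕ ↦ (N n ω - ∫ ω', N n ω' ∂P) /
          ((n : ℝ) ^ (1 / 2 : ℝ) * (Real.log n) ^ (1 + δ)))
        atTop (𝓝 0)) := by
  have hlaw := fun n ↦ EllipsesModel.numCovering_law hu.le hε₀ hΞ n
  obtain rfl : N = fun n ω ↦ ((EllipsesModel.numCovering (Ξ ω) ε n).toNat : ℝ) := by
    ext n ω
    exact hN n ω
  have hmean := fun n ↦ poisson_law_mean (hlaw n).2
  simp only [fun n ↦ (hmean n).2]
  refine ⟨fun n ↦ ⟨(hlaw n).1, (hmean n).1⟩, fun hα1 ↦ ?_, ?_⟩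
  · obtain ⟨c, C, hc, hC, h⟩ := EllipsesModel.mean_bounds hu hε₀ hε
      (EllipsesModel.integral_min_asymp_of_lt_one ρ hρ hα1)
    refine ⟨EllipsesModel.isTheta_of_eventually_bounds hc
      (Eventually.of_forall fun n ↦ by positivity) h, fun δ hδ ↦ ?_⟩
    refine poisson_ae_tendsto (fun n ↦ (hlaw n).2) ?_ fun η hη ↦
      EllipsesModel.chernoff_rate_of_lt_one hα1 hδ hC hη (h.mono fun _ hn ↦ hn.2)
    filter_upwards [eventually_gt_atTop 1] with n hn
    have hn1 : (1 : ℝ) < n := by exact_mod_cast hn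
    have := Real.log_pos hn1
    positivity
  · rintro rfl
    obtain ⟨c, C, hc, hC, h⟩ := EllipsesModel.mean_bounds hu hε₀ hε
      (EllipsesModel.integral_min_asymp_of_eq_one ρ hρ)
    refine ⟨EllipsesModel.isTheta_of_eventually_bounds hc
      (Eventually.of_forall fun n ↦ Real.log_natCast_nonneg n) h, fun δ hδ ↦ ?_⟩
    refine poisson_ae_tendsto (fun n ↦ (hlaw n).2) ?_ fun η hη ↦
      EllipsesModel.chernoff_rate_of_eq_one hδ hη (h.mono fun _ hn ↦ hn.2)
    filter_upwards [eventually_gt_atTop 1] with n hn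
    have hn1 : (1 : ℝ) < n := by exact_mod_cast hn
    have := Real.log_pos hn1
    positivity
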